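/- Let $\mathcal A$ be an alphabet with $k$ letters, let $<_A$ and $<_D$ be strict total orders on $\mathcal A$ such that $<_D$ is the reverse of $<_A$, and let $L$ be a language over $\mathcal A$, that is, a set of finite words over $\mathcal A$ which contains the empty word, is closed under taking factors, and is extendable: for each $v\in L$ there are letters $a,b$ with $av\in L$ and $vb\in L$. A word $w\in L$ is bispecial if there are at least two letters $x$ with $xw\in L$ and at least two letters $y$ with $wy\in L$. Suppose that $L$ satisfies the (symmetric) order condition for $(<_A,<_D)$: for every bispecial word $v$ of $L$, whenever $xvy$ and $x'vy'$ are in $L$ with letters $x\ne x'$ and $y\ne y'$, then $x<_A x'$ if and only if $y<_D y'$. Let $PC(n)$ be the number of distinct palindromes of length $n$ in $L$. Then, for every $n\ge 0$, $PC(n)\le 1$ if $n$ is even and $PC(n)\le k$ if $n$ is odd. Suppose furthermore that every letter of $\mathcal A$ occurs in $L$, that $L$ is the set of all finite factors of some one-sided infinite or bi-infinite word, that $L$ is closed under reversal ($w_1\cdots w_n\in L$ if and only if $w_n\cdots w_1\in L$), and that $L$ has no connection: there are no bispecial word $w$ of $L$ and letters $a<_A a'$ consecutive for $<_A$, $b<_D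 b'$ consecutive for $<_D$, such that $awb\in L$, $a'wb'\in L$, $awb'\notin L$ and $a'wb\notin L$. Then, for every $n\ge 0$, $PC(n)=1$ if $n$ is even and $PC(n)=k$ if $n$ is odd. -/

import Mathlib

/-- A (factorial, extendable) language over the alphabet `α`: it contains the empty word, deleting
the first or the last letter of a word of the language gives a word of the language, and every word
of the language can be extended by a letter on the left and by a letter on the right. -/
structure IsFactorialExtendable {α : Type*} (L : Language α) : Prop where
  nil_mem : [] ∈ L
  of_cons_mem : ∀ (a : α) (u : List α), a :: u ∈ L → u ∈ L
  of_concat_mem : ∀ (u : List α) (b : α), u ++ [b] ∈ L → u ∈ L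
  extend_left : ∀ v ∈ L, ∃ a : α, a :: v ∈ L
  extend_right : ∀ v ∈ L, ∃ b : α, v ++ [b] ∈ L

/-- `w` is right special in `L`: it has more than one right extension in `L`. -/
def IsRightSpecial {α : Type*} (L : Language α) (w : List α) : Prop :=
  w ∈ L ∧ ∃ y y' : α, y ≠ y' ∧ w ++ [y] ∈ L ∧ w ++ [y'] ∈ L

/-- `w` is left special in `L`: it has more than one left extension in `L`. -/
def IsLeftSpecial {α : Type*} (L : Language α) (w : List α) : Prop :=
  w ∈ L ∧ ∃ x x' : α, x ≠ x' ∧ x :: w ∈ L ∧ x' :: w ∈ L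

/-- `w` is bispecial in `L`. -/
def IsBispecial {α : Type*} (L : Language α) (w : List α) : Prop :=
  IsRightSpecial L w ∧ IsLeftSpecial L w

/-- The language `L` satisfies the order condition for the pair of orders `(ltA, ltD)`: for every
bispecial word `v`, whenever `xvy` and `x'vy'` are in `L` with `x ≠ x'` and `y ≠ y'`, one has
`x <_A x'` if and only if `y <_D y'`. -/
def SatisfiesOrderCondition {α : Type*} (ltA ltD : α → α → Prop) (L : Language α) : Prop :=
  ∀ v : List α, IsBispecial L v → ∀ x x' y y' : α, x ≠ x' → y ≠ y' →
    x :: (v ++ [y]) ∈ L → x' :: (v ++ [y']) ∈ L → (ltA x x' ↔ ltD y y')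

/-- `a < b` are consecutive letters for the order `lt` on the alphabet. -/
def AreConsecutive {α : Type*} (lt : α → α → Prop) (a b : α) : Prop :=
  lt a b ∧ ¬ ∃ c : α, lt a c ∧ lt c b

/-- The word `w` (meant to be bispecial in `L`) has a connection: there are letters `a <_A a'`
consecutive for `<_A` and `b <_D b'` consecutive for `<_D` such that `awb` and `a'wb'` are in `L`
and neither `awb'` nor `a'wb` is in `L`. -/
def HasConnectionAt {α : Type*} (ltA ltD : α → α → Prop) (L : Language α) (w : List α) : Prop :=
  ∃ a a' b b' : α, AreConsecutive ltA a a' ∧ AreConsecutive ltD b b' ∧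
    a :: (w ++ [b]) ∈ L ∧ a' :: (w ++ [b']) ∈ L ∧
    a :: (w ++ [b']) ∉ L ∧ a' :: (w ++ [b]) ∉ L

/-- No bispecial word of `L` has a connection. -/
def HasNoConnection {α : Type*} (ltA ltD : α → α → Prop) (L : Language α) : Prop :=
  ∀ w : List α, IsBispecial L w → ¬ HasConnectionAt ltA ltD L w

/-- `L` is closed under reversal. -/
def IsClosedUnderReversal {α : Type*} (L : Language α) : Prop :=
  ∀ w : List α, w ∈ L ↔ w.reverse ∈ L

/-- `L` is generated by the one-sided infinite word `x`: it consists of all the factors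
`x_i x_{i+1} ⋯ x_{i+n-1}` of `x`. -/
def IsGeneratedByInfinite {α : Type*} (L : Language α) (x : ℕ → α) : Prop :=
  ∀ w : List α, w ∈ L ↔ ∃ i n : ℕ, w = List.ofFn (fun j : Fin n => x (i + j))

/-- `L` is generated by the bi-infinite word `x`: it consists of all the factors of `x`. -/
def IsGeneratedByBiinfinite {α : Type*} (L : Language α) (x : ℤ → α) : Prop :=
  ∀ w : List α, w ∈ L ↔ ∃ (i : ℤ) (n : ℕ), w = List.ofFn (fun j : Fin n => x (i + (j : ℕ)))

/-- The palindromic complexity: the number of distinct palindromes of length `n` in `L`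
(a finite number when the alphabet is finite). -/
noncomputable def palindromicComplexity {α : Type*} (L : Language α) (n : ℕ) : ℕ :=
  Set.ncard {w : List α | w ∈ L ∧ w.length = n ∧ w.reverse = w}

/-! Removing both end letters sends palindromes of length `n + 2` to palindromes of length `n`. As
the two orders are opposite, for each `v` the relation `x v y ∈ L` between `x` and `y` is antitone,
so it meets the diagonal at most once and the map is injective. If `v` is a palindrome and `L` is
closed under reversal, the relation is symmetric; missing the diagonal, it would jump across it
between two consecutive letters, which is a connection. Without connections the map is thus also
surjective, and lengths 0 and 1 decide everything. -/

theorem IsFactorialExtendable.exists_extend_both {α : Type*} {L : Language α}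
    (hL : IsFactorialExtendable L) {v : List α} (hv : v ∈ L) : ∃ x y : α, x :: (v ++ [y]) ∈ L := by
  obtain ⟨y, hy⟩ := hL.extend_right v hv
  obtain ⟨x, hx⟩ := hL.extend_left _ hy
  exact ⟨x, y, hx⟩

theorem IsFactorialExtendable.isBispecial_of_mem {α : Type*} {L : Language α}
    (hL : IsFactorialExtendable L) {v : List α} {x x' y y' : α} (hx : x ≠ x') (hy : y ≠ y')
    (h : x :: (v ++ [y]) ∈ L) (h' : x' :: (v ++ [y']) ∈ L) : IsBispecial L v := by
  have hv : v ∈ L := hL.of_concat_mem _ _ (hL.of_cons_mem _ _ h)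
  exact ⟨⟨hv, y, y', hy, hL.of_cons_mem _ _ h, hL.of_cons_mem _ _ h'⟩,
    ⟨hv, x, x', hx, hL.of_concat_mem (x :: v) y h, hL.of_concat_mem (x' :: v) y' h'⟩⟩

/-- Under the symmetric order condition, the right extension is an antitone relation of the left
extension. -/
theorem SatisfiesOrderCondition.le_of_lt {α : Type*} [LinearOrder α] {L : Language α}
    (hL : IsFactorialExtendable L)
    (hord : SatisfiesOrderCondition (fun a b : α => a < b) (fun a b : α => b < a) L)
    {v : List α} {x x' y y' : α} (hx : x < x')
    (h : x :: (v ++ [y]) ∈ L) (h' : x' :: (v ++ [y']) ∈ L) : y' ≤ y := by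
  by_contra hy
  have hlt := lt_of_not_ge hy
  exact lt_asymm hlt
    ((hord v (hL.isBispecial_of_mem hx.ne hlt.ne h h') x x' y y' hx.ne hlt.ne h h').1 hx)

/-- A word has at most one extension by the same letter on both sides. -/
theorem SatisfiesOrderCondition.eq_of_mem {α : Type*} [LinearOrder α] {L : Language α}
    (hL : IsFactorialExtendable L)
    (hord : SatisfiesOrderCondition (fun a b : α => a < b) (fun a b : α => b < a) L)
    {v : List α} {x x' : α} (h : x :: (v ++ [x]) ∈ L) (h' : x' :: (v ++ [x']) ∈ L) : x = x' := by
  rcases lt_trichotomy x x' with hx | hx | hx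
  · exact absurd (hord.le_of_lt hL hx h h') (not_le_of_gt hx)
  · exact hx
  · exact absurd (hord.le_of_lt hL hx h' h) (not_le_of_gt hx)

/-- The set of right extensions of a word is convex for the order on the alphabet. -/
theorem SatisfiesOrderCondition.concat_mem_of_between {α : Type*} [LinearOrder α] {L : Language α}
    (hL : IsFactorialExtendable L)
    (hord : SatisfiesOrderCondition (fun a b : α => a < b) (fun a b : α => b < a) L)
    (hall : ∀ a : α, [a] ∈ L) (w : List α) {y₁ y₂ y₃ : α} (h₁₂ : y₁ < y₂) (h₂₃ : y₂ < y₃)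
    (h₁ : w ++ [y₁] ∈ L) (h₃ : w ++ [y₃] ∈ L) : w ++ [y₂] ∈ L := by
  induction w with
  | nil => exact hall y₂
  | cons x v ih =>
    obtain ⟨x', hx'⟩ := hL.extend_left _ (ih (hL.of_cons_mem _ _ h₁) (hL.of_cons_mem _ _ h₃))
    -- A left extension `x' ≠ x` of `v y₂` would break antitonicity against `x v y₁` or `x v y₃`.
    rcases lt_trichotomy x x' with hx | rfl | hx
    · exact absurd (hord.le_of_lt hL hx h₁ hx') (not_le_of_gt h₁₂)
    · exact hx'
    · exact absurd (hord.le_of_lt hL hx hx' h₃) (not_le_of_gt h₂₃)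

/-- Without connections, every palindrome extends to a palindrome. -/
theorem SatisfiesOrderCondition.exists_palindromic_extension {α : Type*} [LinearOrder α] [Finite α]
    {L : Language α} (hL : IsFactorialExtendable L)
    (hord : SatisfiesOrderCondition (fun a b : α => a < b) (fun a b : α => b < a) L)
    (hall : ∀ a : α, [a] ∈ L) (hrev : IsClosedUnderReversal L)
    (hconn : HasNoConnection (fun a b : α => a < b) (fun a b : α => b < a) L)
    {v : List α} (hv : v ∈ L) (hpal : v.reverse = v) : ∃ x : α, x :: (v ++ [x]) ∈ L := by
  by_contra! hdiag
  have symm : ∀ {x y : α}, x :: (v ++ [y]) ∈ L → y :: (v ++ [x]) ∈ L := fun {x y} h => by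
    simpa [hpal] using (hrev _).1 h
  have ext : ∀ {x : α}, v ++ [x] ∈ L → ∃ y, x :: (v ++ [y]) ∈ L := fun {x} h => by
    obtain ⟨y, hy⟩ := hL.extend_left _ h
    exact ⟨y, symm hy⟩
  have right : ∀ {x y : α}, x :: (v ++ [y]) ∈ L → v ++ [y] ∈ L := fun h => hL.of_cons_mem _ _ h
  -- `P` and `Q` collect the letters paired with a larger, respectively smaller, letter.
  let P : Set α := {x | ∃ y, x < y ∧ x :: (v ++ [y]) ∈ L}
  let Q : Set α := {x | ∃ y, y < x ∧ x :: (v ++ [y]) ∈ L}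
  have cover : ∀ {x : α}, v ++ [x] ∈ L → x ∈ P ∨ x ∈ Q := fun {x} h => by
    obtain ⟨y, hy⟩ := ext h
    rcases lt_trichotomy x y with hxy | rfl | hxy
    · exact Or.inl ⟨y, hxy, hy⟩
    · exact absurd hy (hdiag x)
    · exact Or.inr ⟨y, hxy, hy⟩
  have below : ∀ {p q : α}, p ∈ P → q ∈ Q → p < q := by
    rintro p q ⟨y, hpy, hy⟩ ⟨z, hzq, hz⟩
    rcases lt_trichotomy p q with h | rfl | h
    · exact h
    -- The right extensions of `p v` include letters on both sides of `p`, hence `p` by convexity.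
    · exact absurd (hord.concat_mem_of_between hL hall (p :: v) hzq hpy hz hy) (hdiag p)
    · exact absurd (hord.le_of_lt hL h hz hy) (not_le_of_gt (hzq.trans (h.trans hpy)))
  obtain ⟨x, y, hxy⟩ := hL.exists_extend_both hv
  have hne : P.Nonempty ∧ Q.Nonempty := by
    rcases lt_trichotomy x y with h | rfl | h
    · exact ⟨⟨x, y, h, hxy⟩, ⟨y, x, h, symm hxy⟩⟩
    · exact absurd hxy (hdiag x)
    · exact ⟨⟨y, x, h, symm hxy⟩, ⟨x, y, h, hxy⟩⟩
  obtain ⟨a, ha, hamax⟩ := Set.exists_max_image P id P.toFinite hne.1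
  obtain ⟨a', ha', hamin⟩ := Set.exists_min_image Q id Q.toFinite hne.2
  have haa' : a < a' := below ha ha'
  obtain ⟨b, hab, hb⟩ := ha
  obtain ⟨c, hca', hc⟩ := ha'
  have gap : ∀ {z : α}, v ++ [z] ∈ L → a < z → a' ≤ z := fun {z} hz haz => by
    rcases cover hz with h | h
    · exact absurd (hamax z h) (not_le_of_gt haz)
    · exact hamin z h
  have hcons : ¬ ∃ z, a < z ∧ z < a' := by
    rintro ⟨z, h₁, h₂⟩
    have hz := hord.concat_mem_of_between hL hall v h₁ h₂ (right (symm hb)) (right (symm hc))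
    exact absurd (gap hz h₁) (not_le_of_gt h₂)
  -- If `b > a'`, antitonicity applied to `a' v c` and `b v a` gives `a ≤ c < a'`, so `c = a`.
  have hmem : a :: (v ++ [a']) ∈ L := by
    rcases (gap (right hb) hab).lt_or_eq with h | rfl
    · have hac : a ≤ c := hord.le_of_lt hL h hc (symm hb)
      rcases hac.lt_or_eq with h' | rfl
      · exact absurd ⟨c, h', hca'⟩ hcons
      · exact symm hc
    · exact hb
  -- The right-hand pair is `a', a` because the second order is reversed; the two missing words are
  -- then the diagonal ones.
  refine hconn v (hL.isBispecial_of_mem haa'.ne haa'.ne' hmem (symm hmem))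
    ⟨a, a', a', a, ⟨haa', hcons⟩, ⟨haa', ?_⟩, hmem, symm hmem, hdiag a, hdiag a'⟩
  rintro ⟨z, h₁, h₂⟩
  exact hcons ⟨z, h₂, h₁⟩

/-- The palindromes of length `n` in `L`. -/
def palindromesOfLength {α : Type*} (L : Language α) (n : ℕ) : Set (List α) :=
  {w : List α | w ∈ L ∧ w.length = n ∧ w.reverse = w}

theorem finite_palindromesOfLength {α : Type*} [Finite α] (L : Language α) (n : ℕ) :
    (palindromesOfLength L n).Finite :=
  (List.finite_length_eq α n).subset fun _ hw => hw.2.1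

theorem exists_eq_of_mem_palindromesOfLength {α : Type*} {L : Language α}
    (hL : IsFactorialExtendable L) {n : ℕ} {w : List α} (hw : w ∈ palindromesOfLength L (n + 2)) :
    ∃ a : α, ∃ u ∈ palindromesOfLength L n, w = a :: (u ++ [a]) := by
  obtain ⟨hwL, hlen, hrev⟩ := hw
  cases List.Palindrome.of_reverse_eq hrev with
  | nil => simp at hlen
  | singleton x => simp at hlen
  | @cons_concat a u hu =>
    exact ⟨a, u, ⟨hL.of_concat_mem _ _ (hL.of_cons_mem _ _ hwL), by simpa using hlen,
      hu.reverse_eq⟩, rfl⟩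

theorem mapsTo_palindromesOfLength {α : Type*} {L : Language α}
    (hL : IsFactorialExtendable L) (n : ℕ) :
    Set.MapsTo (fun w : List α => w.tail.dropLast) (palindromesOfLength L (n + 2))
      (palindromesOfLength L n) := by
  intro w hw
  obtain ⟨a, u, hu, rfl⟩ := exists_eq_of_mem_palindromesOfLength hL hw
  simpa using hu

/-- Stripping is injective: the core determines the outer letter. -/
theorem SatisfiesOrderCondition.palindromicComplexity_add_two_le {α : Type*} [LinearOrder α]
    [Finite α] {L : Language α} (hL : IsFactorialExtendable L)
    (hord : SatisfiesOrderCondition (fun a b : α => a < b) (fun a b : α => b < a) L) (n : ℕ) :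
    palindromicComplexity L (n + 2) ≤ palindromicComplexity L n := by
  refine Set.ncard_le_ncard_of_injOn _ (mapsTo_palindromesOfLength hL n) ?_
    (finite_palindromesOfLength L n)
  intro w hw w' hw' h
  obtain ⟨a, u, -, rfl⟩ := exists_eq_of_mem_palindromesOfLength hL hw
  obtain ⟨a', u', -, rfl⟩ := exists_eq_of_mem_palindromesOfLength hL hw'
  obtain rfl : u = u' := by simpa using h
  rw [hord.eq_of_mem hL hw.1 hw'.1]

theorem SatisfiesOrderCondition.le_palindromicComplexity_add_two {α : Type*} [LinearOrder α]
    [Finite α] {L : Language α} (hL : IsFactorialExtendable L)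
    (hord : SatisfiesOrderCondition (fun a b : α => a < b) (fun a b : α => b < a) L)
    (hall : ∀ a : α, [a] ∈ L) (hrev : IsClosedUnderReversal L)
    (hconn : HasNoConnection (fun a b : α => a < b) (fun a b : α => b < a) L) (n : ℕ) :
    palindromicComplexity L n ≤ palindromicComplexity L (n + 2) := by
  have hsurj : palindromesOfLength L n ⊆
      (fun w : List α => w.tail.dropLast) '' palindromesOfLength L (n + 2) := by
    rintro u ⟨huL, hlen, hu⟩
    obtain ⟨x, hx⟩ := hord.exists_palindromic_extension hL hall hrev hconn huL hu
    exact ⟨x :: (u ++ [x]), ⟨hx, by simp [hlen], by simp [hu]⟩, by simp⟩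
  exact (Set.ncard_le_ncard hsurj ((finite_palindromesOfLength L _).image _)).trans
    (Set.ncard_image_le (finite_palindromesOfLength L _))

theorem palindromicComplexity_zero {α : Type*} {L : Language α} (hL : IsFactorialExtendable L) :
    palindromicComplexity L 0 = 1 := by
  rw [palindromicComplexity, Set.ncard_eq_one]
  refine ⟨[], Set.ext fun w => ⟨fun hw => List.length_eq_zero_iff.1 hw.2.1, ?_⟩⟩
  rintro rfl
  exact ⟨hL.nil_mem, rfl, rfl⟩

theorem palindromicComplexity_one {α : Type*} (L : Language α) :
    palindromicComplexity L 1 = {a : α | [a] ∈ L}.ncard := by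
  rw [← Set.ncard_image_of_injective {a : α | [a] ∈ L} (List.singleton_injective (α := α)),
    palindromicComplexity]
  congr 1
  ext w
  constructor
  · rintro ⟨hw, hlen, -⟩
    obtain ⟨a, rfl⟩ := List.length_eq_one_iff.1 hlen
    exact ⟨a, hw, rfl⟩
  · rintro ⟨a, ha, rfl⟩
    exact ⟨ha, rfl, rfl⟩

theorem mainTheorem6 {α : Type*} [Fintype α] (k : ℕ) (hk : Fintype.card α = k)
    (ltA ltD : α → α → Prop) (hA : IsStrictTotalOrder α ltA) (hD : IsStrictTotalOrder α ltD)
    (hsymm : ∀ a b : α, ltD a b ↔ ltA b a)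
    (L : Language α) (hL : IsFactorialExtendable L)
    (hord : SatisfiesOrderCondition ltA ltD L) :
    (∀ n : ℕ, (Even n → palindromicComplexity L n ≤ 1) ∧
      (Odd n → palindromicComplexity L n ≤ k)) ∧
    ((∀ a : α, [a] ∈ L) →
      ((∃ x : ℕ → α, IsGeneratedByInfinite L x) ∨ (∃ x : ℤ → α, IsGeneratedByBiinfinite L x)) →
      IsClosedUnderReversal L →
      HasNoConnection ltA ltD L →
      ∀ n : ℕ, (Even n → palindromicComplexity L n = 1) ∧
        (Odd n → palindromicComplexity L n = k)) := by
  classical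
  letI : LinearOrder α := linearOrderOfSTO ltA
  obtain rfl : ltD = fun a b => ltA b a := funext₂ fun a b => propext (hsymm a b)
  have hord' : SatisfiesOrderCondition (fun a b : α => a < b) (fun a b : α => b < a) L := hord
  constructor
  · intro n
    induction n using Nat.twoStepInduction with
    | zero => exact ⟨fun _ => (palindromicComplexity_zero hL).le, fun h => absurd h (by decide)⟩
    | one =>
      refine ⟨fun h => absurd h (by decide), fun _ => ?_⟩
      rw [palindromicComplexity_one, ← hk, ← Nat.card_eq_fintype_card]
      exact Set.ncard_le_card _
    | more n ih _ =>
      have hle := hord'.palindromicComplexity_add_two_le hL n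
      exact ⟨fun h => hle.trans (ih.1 (by simpa [Nat.even_add] using h)),
        fun h => hle.trans (ih.2 (by simpa [Nat.odd_add] using h))⟩
  · intro hall _ hrev hconn n
    induction n using Nat.twoStepInduction with
    | zero => exact ⟨fun _ => palindromicComplexity_zero hL, fun h => absurd h (by decide)⟩
    | one =>
      refine ⟨fun h => absurd h (by decide), fun _ => ?_⟩
      rw [palindromicComplexity_one, Set.eq_univ_of_forall (s := {a : α | [a] ∈ L}) hall,
        Set.ncard_univ, Nat.card_eq_fintype_card, hk]
    | more n ih _ =>
      have heq := (hord'.palindromicComplexity_add_two_le hL n).antisymm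
        (hord'.le_palindromicComplexity_add_two hL hall hrev hconn n)
      exact ⟨fun h => heq.trans (ih.1 (by simpa [Nat.even_add] using h)),
        fun h => heq.trans (ih.2 (by simpa [Nat.odd_add] using h))⟩
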